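/- **Theorem.** Let $M$ be a (real, smooth) supermanifold of dimension $p|q$ with an odd Poisson structure, i.e. an odd function $\mathfrak S=\tfrac12\mathfrak S^{ab}(x)p_bp_a$ on $T^*M$, quadratic in the momenta, whose odd bracket $$\{f,g\}=-(-1)^{\tilde f(\tilde a+1)}\mathfrak S^{ab}\,\frac{\partial f}{\partial x^b}\frac{\partial g}{\partial x^a}$$ satisfies the Jacobi identity (a tilde denotes parity, derivatives are left derivatives). Let $X_f=(-1)^{\tilde f+1}\{f,\cdot\}$ be the Hamiltonian vector field of $f$. For a nondegenerate (even) volume form $\rho$ let $$\Delta_\rho f=\frac{L_{X_f}\rho}{\rho}$$ be the odd Laplacian on functions, where $L_X(\rho\,Dx)=(-1)^{\tilde a(\tilde X+1)}\partial_a(\rho X^a)\,Dx$ in local coordinates, and let $$\Delta s=\rho^{1/2}\,\Delta_\rho\bigl(s\,\rho^{-1/2}\bigr)$$ be the odd Laplacian on half-densities $s$ (densities of weight $1/2$) defined by $\rho$; here $\rho^{1/2}$ denotes the half-density $|\rho|^{1/2}$. Let $\sigma$ be an even function on $M$, let $\rho'=e^{\sigma}\rho$, and let $\Delta'$ be the Laplacian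 on half-densities defined by $\rho'$. Then, for every half-density $s$ and in all local coordinates, $$\Delta' s=\Delta s-\bigl(e^{-\sigma/2}\Delta_\rho e^{\sigma/2}\bigr)s=\Delta s-\tfrac12 H(\rho',\rho)\,s ,$$ where $H(\rho',\rho)$ is the odd function $$H(\rho',\rho)=\Delta_\rho\sigma-\tfrac12\{\sigma,\sigma\}=2e^{-\sigma/2}\Delta_\rho e^{\sigma/2}.$$ -/

import Mathlib

open scoped Manifold ContDiff TensorProduct
open TopologicalSpace CategoryTheory

universe u

noncomputable section

namespace OddPoisson

/-! ## Superdomains -/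

/-- Smooth real functions on an open subset of `ℝᵖ`. -/
abbrev CInf {p : ℕ} (V : Opens (EuclideanSpace ℝ (Fin p))) : Type :=
  C^∞⟮𝓘(ℝ, EuclideanSpace ℝ (Fin p)), V; 𝓘(ℝ, ℝ), ℝ⟯

/-- The Grassmann algebra on `q` generators. -/
abbrev Grass (q : ℕ) : Type := ExteriorAlgebra ℝ (Fin q → ℝ)

/-- The superalgebra `C^∞(V) ⊗ Λ(θ₁, …, θ_q)` of functions on the superdomain
of dimension `p|q` over the open set `V ⊆ ℝᵖ`. -/
abbrev SF {p : ℕ} (q : ℕ) (V : Opens (EuclideanSpace ℝ (Fin p))) : Type :=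
  CInf V ⊗[ℝ] Grass q

/-- The parity of a coordinate: `xⁱ` (`Sum.inl i`) is even, `θʲ` (`Sum.inr j`) is odd. -/
def par {p q : ℕ} : Fin p ⊕ Fin q → ZMod 2
  | Sum.inl _ => 0
  | Sum.inr _ => 1

/-- The sign `(-1)ᵏ`. -/
def sgn (k : ZMod 2) : ℝ := (-1) ^ k.val

section Superdomain

variable {p q : ℕ} {V V' : Opens (EuclideanSpace ℝ (Fin p))}

/-- The extension of a smooth function on `V` by zero. Near the points of `V` it is smooth. -/
def extZero (f : CInf V) : EuclideanSpace ℝ (Fin p) → ℝ := Function.extend Subtype.val f 0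

theorem contDiffAt_extZero (f : CInf V) (x : V) : ContDiffAt ℝ ∞ (extZero f) x := by
  rw [← contMDiffAt_iff_contDiffAt, ← contMDiffAt_subtype_iff]
  have h : (fun y : V => extZero f y) = f := by
    funext y
    exact Subtype.val_injective.extend_apply _ _ _
  rw [h]
  exact f.contMDiff x

/-- Composition of a smooth function with a function of one variable that is smooth near
all of its values. -/
def compReal (g : ℝ → ℝ) (b : CInf V) (hg : ∀ x, ContDiffAt ℝ ∞ g (b x)) : CInf V :=
  ⟨fun x => g (b x), fun x => (hg x).contMDiffAt.comp x (b.contMDiff x)⟩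

/-- The partial derivative `∂f/∂xⁱ` of a smooth function on `V`. -/
def partialFun (i : Fin p) (f : CInf V) : CInf V :=
  ⟨fun x => fderiv ℝ (extZero f) x (EuclideanSpace.single i 1), by
    intro x
    rw [contMDiffAt_subtype_iff
      (f := fun y => fderiv ℝ (extZero f) y (EuclideanSpace.single i 1)),
      contMDiffAt_iff_contDiffAt]
    exact ((contDiffAt_extZero f x).fderiv_right (m := ∞) (by simp)).clm_apply
      contDiffAt_const⟩

/-- `∂/∂xⁱ` as a linear map on smooth functions. -/
def partialX (i : Fin p) : CInf V →ₗ[ℝ] CInf V where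
  toFun := partialFun i
  map_add' f g := by
    ext x
    have h : extZero (f + g) = extZero f + extZero g := by
      unfold extZero
      rw [← Function.extend_add, add_zero]
      rfl
    have hf := (contDiffAt_extZero f x).differentiableAt (by simp)
    have hg := (contDiffAt_extZero g x).differentiableAt (by simp)
    change fderiv ℝ (extZero (f + g)) x _ =
      fderiv ℝ (extZero f) x _ + fderiv ℝ (extZero g) x _
    rw [h, fderiv_add hf hg]
    rfl
  map_smul' r f := by
    ext x
    have h : extZero (r • f) = r • extZero f := by
      unfold extZero
      rw [← Function.extend_smul, smul_zero]
      rfl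
    have hf := (contDiffAt_extZero f x).differentiableAt (by simp)
    change fderiv ℝ (extZero (r • f)) x _ = r * fderiv ℝ (extZero f) x _
    rw [h, fderiv_const_smul hf]
    rfl

/-- Restriction of smooth functions. -/
def resFun (h : V' ≤ V) : CInf V →ₐ[ℝ] CInf V' where
  toFun f := ⟨fun x => f (Set.inclusion h x), f.contMDiff.comp (contMDiff_inclusion h)⟩
  map_one' := rfl
  map_mul' _ _ := rfl
  map_zero' := rfl
  map_add' _ _ := rfl
  commutes' _ := rfl

/-- Restriction of superfunctions. -/
def resSF (h : V' ≤ V) : SF q V →ₐ[ℝ] SF q V' :=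
  Algebra.TensorProduct.map (resFun h) (AlgHom.id ℝ (Grass q))

/-- Even (`k = 0`) and odd (`k = 1`) superfunctions. -/
def homog (q : ℕ) (V : Opens (EuclideanSpace ℝ (Fin p))) (k : ZMod 2) :
    Submodule ℝ (SF q V) :=
  LinearMap.range (LinearMap.lTensor (CInf V)
    (CliffordAlgebra.evenOdd (0 : QuadraticForm ℝ (Fin q → ℝ)) k).subtype)

/-- The parity involution, equal to `(-1)ᵏ` on superfunctions of parity `k`. -/
def parityInv : Module.End ℝ (SF q V) :=
  LinearMap.lTensor (CInf V)
    (CliffordAlgebra.involute (Q := (0 : QuadraticForm ℝ (Fin q → ℝ)))).toLinearMap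

/-- The operator `f ↦ (-1)^{k·f̃} f` (linearly extended to inhomogeneous `f`). -/
def twist (k : ZMod 2) : Module.End ℝ (SF q V) := parityInv ^ k.val

/-- The (left) partial derivative with respect to the coordinate with index `a`: the
derivative of the coefficients for `xⁱ`, and the left contraction of the Grassmann algebra
for `θʲ`. -/
def pd : Fin p ⊕ Fin q → (SF q V →ₗ[ℝ] SF q V)
  | Sum.inl i => LinearMap.rTensor (Grass q) (partialX i)
  | Sum.inr j => LinearMap.lTensor (CInf V)
      (CliffordAlgebra.contractLeft (Q := (0 : QuadraticForm ℝ (Fin q → ℝ)))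
        (LinearMap.proj j : (Fin q → ℝ) →ₗ[ℝ] ℝ))

/-- The coordinate functions `xⁱ` and `θʲ`. -/
def coord : Fin p ⊕ Fin q → SF q V
  | Sum.inl i => (⟨fun x => (x : EuclideanSpace ℝ (Fin p)) i, by
      intro x
      rw [contMDiffAt_subtype_iff (f := fun y : EuclideanSpace ℝ (Fin p) => y i),
        contMDiffAt_iff_contDiffAt]
      exact (EuclideanSpace.proj (𝕜 := ℝ) i).contDiff.contDiffAt⟩ : CInf V) ⊗ₜ 1
  | Sum.inr j => 1 ⊗ₜ ExteriorAlgebra.ι ℝ (Pi.single j 1)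

/-- The inclusion of ordinary smooth functions. -/
def ofFun (b : CInf V) : SF q V := b ⊗ₜ 1

/-- The body (value at `θ = 0`) of a superfunction. -/
def body : SF q V →ₐ[ℝ] CInf V :=
  (Algebra.TensorProduct.rid ℝ ℝ (CInf V)).toAlgHom.comp
    (Algebra.TensorProduct.map (AlgHom.id ℝ (CInf V)) ExteriorAlgebra.algebraMapInv)

/-- The exponential of an (even) superfunction `f = b + n` with body `b`: the Taylor expansion
`eᵇ ∑ nᵏ / k!`, which stops because `n ^ (q + 1) = 0`. -/
def superExp (f : SF q V) : SF q V :=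
  ofFun (compReal Real.exp (body f) fun _ => Real.contDiff_exp.contDiffAt) *
    ∑ k ∈ Finset.range (q + 1), ((k.factorial : ℝ)⁻¹) • (f - ofFun (body f)) ^ k

theorem contDiffAt_abs_rpow (w : ℝ) {t : ℝ} (ht : t ≠ 0) :
    ContDiffAt ℝ ∞ (fun t : ℝ => |t| ^ w) t :=
  (contDiffAt_abs ht).rpow_const_of_ne (abs_ne_zero.mpr ht)

open Classical in
/-- The power `|f|ʷ` of an even superfunction `f = b (1 + n)` whose body `b` vanishes nowhere:
the binomial expansion `|b|ʷ ∑ (w choose k) nᵏ`, which stops because `n ^ (q + 1) = 0`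
(and `0` by convention if the body has a zero). -/
def absPow (w : ℝ) (f : SF q V) : SF q V :=
  if h : ∀ x, body f x ≠ 0 then
    ofFun (compReal (fun t => |t| ^ w) (body f) fun x => contDiffAt_abs_rpow w (h x)) *
      ∑ k ∈ Finset.range (q + 1),
        Ring.choose w k • (Ring.inverse (ofFun (body f)) * f - 1) ^ k
  else 0

end Superdomain

/-! ## Berezinians -/

/-- The determinant of a matrix with pairwise commuting entries (Leibniz formula). -/
def detLeibniz {R : Type*} [Ring R] {n : ℕ} (A : Matrix (Fin n) (Fin n) R) : R :=
  ∑ τ : Equiv.Perm (Fin n), ((Equiv.Perm.sign τ : ℤ) : R) *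
    (List.ofFn fun i => A (τ i) i).prod

/-- The Berezinian `det (A - B D⁻¹ C) (det D)⁻¹` of an even invertible supermatrix. -/
def ber {R : Type*} [Ring R] {p q : ℕ} (J : Matrix (Fin p ⊕ Fin q) (Fin p ⊕ Fin q) R) : R :=
  detLeibniz (J.toBlocks₁₁ - J.toBlocks₁₂ * Ring.inverse J.toBlocks₂₂ * J.toBlocks₂₁) *
    Ring.inverse (detLeibniz J.toBlocks₂₂)

/-! ## Supermanifolds -/

/-- A superspace: a topological space with a sheaf of `ℤ/2`-graded real algebras. -/
structure SuperSpace where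
  X : TopCat.{u}
  sheaf : TopCat.Sheaf (AlgCat.{u} ℝ) X
  grading : ∀ U : Opens X, ZMod 2 → Submodule ℝ (sheaf.presheaf.obj (Opposite.op U))
  graded : ∀ U : Opens X, Nonempty (GradedAlgebra (grading U))
  grading_res : ∀ (U W : Opens X) (h : W ≤ U) (k : ZMod 2),
    ∀ f ∈ grading U k, (sheaf.presheaf.map (homOfLE h).op).hom f ∈ grading W k

namespace SuperSpace

variable (M : SuperSpace.{u})

/-- The algebra of functions over an open subset. -/
abbrev Fn (U : Opens M.X) : Type u := M.sheaf.presheaf.obj (Opposite.op U)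

/-- The restriction of functions to a smaller open subset. -/
def res {U W : Opens M.X} (h : W ≤ U) : M.Fn U →ₐ[ℝ] M.Fn W :=
  (M.sheaf.presheaf.map (homOfLE h).op).hom

/-- The image of an open subset under a topological chart. -/
def img {p : ℕ} (e : OpenPartialHomeomorph M.X (EuclideanSpace ℝ (Fin p)))
    (W : Opens M.X) : Opens (EuclideanSpace ℝ (Fin p)) :=
  ⟨e.target ∩ e.symm ⁻¹' W, e.symm.isOpen_inter_preimage W.isOpen⟩

theorem img_mono {p : ℕ} (e : OpenPartialHomeomorph M.X (EuclideanSpace ℝ (Fin p)))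
    {W W' : Opens M.X} (h : W' ≤ W) : M.img e W' ≤ M.img e W :=
  fun _ hx => ⟨hx.1, h hx.2⟩

/-- A local coordinate system: an isomorphism of graded ringed spaces of an open subset `dom`
with a superdomain of dimension `p|q`. -/
structure Chart (p q : ℕ) where
  e : OpenPartialHomeomorph M.X (EuclideanSpace ℝ (Fin p))
  dom : Opens M.X
  dom_eq : (dom : Set M.X) = e.source
  iso : ∀ W : Opens M.X, W ≤ dom → (M.Fn W ≃ₐ[ℝ] SF q (M.img e W))
  iso_res : ∀ (W W' : Opens M.X) (h : W ≤ dom) (h' : W' ≤ W) (f : M.Fn W),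
    iso W' (h'.trans h) (M.res h' f) = resSF (M.img_mono e h') (iso W h f)
  iso_grading : ∀ (W : Opens M.X) (h : W ≤ dom) (k : ZMod 2) (f : M.Fn W),
    f ∈ M.grading W k ↔ iso W h f ∈ homog q (M.img e W) k

end SuperSpace

/-- A supermanifold of dimension `p|q`. -/
structure SuperManifold (p q : ℕ) extends SuperSpace.{u} where
  t2 : T2Space X
  secondCountable : SecondCountableTopology X
  exists_chart : ∀ x : X, ∃ c : toSuperSpace.Chart p q, x ∈ c.dom

namespace SuperManifold

variable {p q : ℕ} (M : SuperManifold.{u} p q)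

/-- The local coordinate systems of a supermanifold. -/
abbrev Chart : Type u := M.toSuperSpace.Chart p q

variable {M}

namespace Chart

/-- The superfunctions on the range of a coordinate system. -/
abbrev Coef (c : M.Chart) : Type := SF q (M.img c.e c.dom)

/-- The common domain of two coordinate systems, in the coordinates of the first. -/
abbrev overlap (c c' : M.Chart) : Opens (EuclideanSpace ℝ (Fin p)) :=
  M.img c.e (c.dom ⊓ c'.dom)

/-- Restriction of a function of the coordinates `c` to the common domain with `c'`. -/
def toOverlap (c c' : M.Chart) : c.Coef →ₐ[ℝ] SF q (c.overlap c') :=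
  resSF (M.img_mono c.e inf_le_left)

/-- The substitution `x' = x'(x)`: a function of the coordinates `c'`, restricted to the common
domain and written in the coordinates `c`. -/
def subst (c c' : M.Chart) (f : c'.Coef) : SF q (c.overlap c') :=
  c.iso (c.dom ⊓ c'.dom) inf_le_left
    ((c'.iso (c.dom ⊓ c'.dom) inf_le_right).symm
      (resSF (M.img_mono c'.e inf_le_right) f))

/-- The Jacobi matrix `∂x'ⁱ/∂xᵃ` (row `a`, column `i`). -/
def jacobi (c c' : M.Chart) :
    Matrix (Fin p ⊕ Fin q) (Fin p ⊕ Fin q) (SF q (c.overlap c')) :=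
  Matrix.of fun a i => pd a (c.subst c' (coord i))

/-- The expression of a global function in local coordinates. -/
def expr (c : M.Chart) (f : M.Fn ⊤) : c.Coef :=
  c.iso c.dom le_rfl (M.res le_top f)

end Chart

/-! ## Odd Poisson structures, volume forms and densities -/

/-- The odd bracket with components `𝔖ᵃᵇ` in a superdomain,
`{f, g} = - ∑ (-1)^{f̃ (ã + 1)} 𝔖ᵃᵇ ∂_b f ∂_a g`. -/
def bracketOf {V : Opens (EuclideanSpace ℝ (Fin p))}
    (S : Fin p ⊕ Fin q → Fin p ⊕ Fin q → SF q V) (f g : SF q V) : SF q V :=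
  -∑ a, ∑ b, S a b * pd b (twist (par a + 1) f) * pd a g

variable (M) in
/-- An odd Poisson structure: an odd function `𝔖 = ½ 𝔖ᵃᵇ(x) p_b p_a` on `T*M`, quadratic in
momenta, given by its components `𝔖ᵃᵇ` in all local coordinates, whose bracket satisfies the
Jacobi identity. The transformation law is that of `p_a = (∂x'ⁱ/∂xᵃ) p'_i`. -/
structure OddPoissonStructure where
  comp : ∀ c : M.Chart, Fin p ⊕ Fin q → Fin p ⊕ Fin q → c.Coef
  parity : ∀ c a b, comp c a b ∈ homog q (M.img c.e c.dom) (par a + par b + 1)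
  symm : ∀ c a b, comp c a b = sgn (par a * par b) • comp c b a
  transform : ∀ (c c' : M.Chart) (i j : Fin p ⊕ Fin q),
    c.subst c' (comp c' i j) =
      ∑ a, ∑ b, sgn (par j * (par a + par i)) •
        (c.toOverlap c' (comp c a b) * c.jacobi c' b j * c.jacobi c' a i)
  jacobi : ∀ (c : M.Chart) (k l : ZMod 2) (f g h : c.Coef),
    f ∈ homog q (M.img c.e c.dom) k → g ∈ homog q (M.img c.e c.dom) l →
    bracketOf (comp c) f (bracketOf (comp c) g h) =
      bracketOf (comp c) (bracketOf (comp c) f g) h +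
        sgn ((k + 1) * (l + 1)) • bracketOf (comp c) g (bracketOf (comp c) f h)

variable (M) in
/-- A (Berezin) volume form `ρ = ρ(x) Dx`, where `Dx' = Dx · Ber (∂x'/∂x)`. -/
structure VolumeForm where
  coef : ∀ c : M.Chart, c.Coef
  even : ∀ c, coef c ∈ homog q (M.img c.e c.dom) 0
  transform : ∀ c c' : M.Chart,
    c.toOverlap c' (coef c) = c.subst c' (coef c') * ber (c.jacobi c')

/-- A volume form is nondegenerate if it is a basis of the module of volume forms. -/
def VolumeForm.Nondegenerate (ρ : M.VolumeForm) : Prop := ∀ c, IsUnit (ρ.coef c)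

variable (M) in
/-- A density `s(x) |Dx|ʷ` of weight `w`, where `|Dx'|ʷ = |Dx|ʷ · |Ber (∂x'/∂x)|ʷ`. -/
structure Density (w : ℝ) where
  coef : ∀ c : M.Chart, c.Coef
  transform : ∀ c c' : M.Chart,
    c.toOverlap c' (coef c) = c.subst c' (coef c') * absPow w (ber (c.jacobi c'))

variable (M) in
/-- Half-densities. -/
abbrev HalfDensity : Type u := M.Density (1 / 2)

/-! ## Laplacians -/

namespace OddPoissonStructure

variable (S : M.OddPoissonStructure)

/-- The odd bracket of two functions in local coordinates. -/
def bracket (c : M.Chart) (f g : c.Coef) : c.Coef := bracketOf (S.comp c) f g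

/-- The components `X_fᵃ = ∑ (-1)^{ã f̃} 𝔖ᵃᵇ ∂_b f` of the Hamiltonian vector field
`X_f = (-1)^{f̃ + 1} {f, ·}`. -/
def hamField (c : M.Chart) (f : c.Coef) (a : Fin p ⊕ Fin q) : c.Coef :=
  ∑ b, S.comp c a b * pd b (twist (par a) f)

end OddPoissonStructure

/-- The coefficient of the Lie derivative `L_X ρ = ∑ (-1)^{ã (X̃ + 1)} ∂_a (ρ Xᵃ) Dx` along
the vector field with components `Xᵃ`. As `Xᵃ` has parity `X̃ + ã`, the sign is that of
`twist (par a) Xᵃ`. -/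
def VolumeForm.lie (ρ : M.VolumeForm) (c : M.Chart) (X : Fin p ⊕ Fin q → c.Coef) : c.Coef :=
  ∑ a, pd a (ρ.coef c * twist (par a) (X a))

/-- The Laplacian on functions, `Δ_ρ f = (L_{X_f} ρ) / ρ`, in local coordinates. -/
def lapFun (S : M.OddPoissonStructure) (ρ : M.VolumeForm) (c : M.Chart) (f : c.Coef) :
    c.Coef :=
  Ring.inverse (ρ.coef c) * ρ.lie c (S.hamField c f)

/-- The odd Laplacian on half-densities, `Δ s = ρ^{1/2} Δ_ρ (s ρ^{-1/2})`: the coefficient of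
`Δ s` in the local coordinates `c`. -/
def lapHalf (S : M.OddPoissonStructure) (ρ : M.VolumeForm) (s : M.HalfDensity)
    (c : M.Chart) : c.Coef :=
  absPow (1 / 2) (ρ.coef c) *
    lapFun S ρ c (s.coef c * Ring.inverse (absPow (1 / 2) (ρ.coef c)))

/-- The Hamiltonian `H(e^σ ρ, ρ) = Δ_ρ σ - ½ {σ, σ}`, in local coordinates. -/
def hamH (S : M.OddPoissonStructure) (ρ : M.VolumeForm) (σ : M.Fn ⊤) (c : M.Chart) : c.Coef :=
  lapFun S ρ c (c.expr σ) - (1 / 2 : ℝ) • S.bracket c (c.expr σ) (c.expr σ)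

end SuperManifold

end OddPoisson

end

/-!
The statement is local, so everything happens in the algebra of superfunctions over one chart.
Write `(u, f)` for `∑ 𝔖ᵃᵇ ∂_b u ∂_a f` (`symbolForm`), which is `-{u, f}` when `u` is even. The
Laplacian on functions is a second-order operator with this principal symbol: for even `u`
* `Δ_ρ (u f) = (Δ_ρ u) f + u Δ_ρ f + 2 (u, f)` (`lapOf_mul`), and
* `Δ_{e^u ρ} f = Δ_ρ f + (u, f)` (`lapOf_superExp_mul`).

Conjugating the second operator with `e^{u/2}` therefore cancels its first-order term against the
one produced by the product rule, and leaves `Δ_ρ` minus multiplication by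
`½ (Δ_ρ u - ½ {u, u})` (`superExp_mul_lapOf_superExp_mul`). By the chain rule for `e^{u/2}` this
function is also `e^{-u/2} Δ_ρ e^{u/2}` (`superExp_mul_lapOf_superExp`). Since the half-density
`|e^u ρ|^{1/2}` is `e^{u/2} |ρ|^{1/2}` (`absPow_half_superExp_mul`), this conjugation is exactly
the passage from the Laplacian on half-densities of `ρ` to that of `e^u ρ`.

Two facts about superfunctions support the calculation. Even superfunctions are central, so that
the derivatives of an even `u` commute with everything up to sign (`pd_mul_eq_twist_mul_pd`). And
a superfunction with zero body has vanishing power `q + 1`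
(`pow_succ_eq_zero_of_body_eq_zero`), so that the finite sums defining exponentials and powers
are values of the full power series (`nilEval`) and inherit their functional equations.
-/

namespace OddPoisson

/-! ### The Grassmann algebra -/

section Grassmann

variable {q : ℕ}

local notation "ι₀" => CliffordAlgebra.ι (0 : QuadraticForm ℝ (Fin q → ℝ))

theorem Grass.ι_mul_ι_swap (m n : Fin q → ℝ) : ι₀ m * ι₀ n = -(ι₀ n * ι₀ m) :=
  eq_neg_of_add_eq_zero_left (ExteriorAlgebra.ι_add_mul_swap m n)

theorem Grass.ι_mul (m : Fin q → ℝ) (x : Grass q) :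
    ι₀ m * x = CliffordAlgebra.involute x * ι₀ m := by
  induction x using CliffordAlgebra.left_induction with
  | algebraMap r => simp [Algebra.commutes]
  | add x y hx hy => rw [mul_add, hx, hy, map_add, add_mul]
  | ι_mul x n hx =>
    rw [← mul_assoc, Grass.ι_mul_ι_swap, neg_mul, mul_assoc, hx, map_mul,
      CliffordAlgebra.involute_ι]
    simp only [neg_mul, mul_assoc]

theorem Grass.even_comm {x : Grass q}
    (hx : x ∈ CliffordAlgebra.evenOdd (0 : QuadraticForm ℝ (Fin q → ℝ)) 0) (y : Grass q) :
    x * y = y * x := by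
  induction x, hx using CliffordAlgebra.even_induction with
  | algebraMap r => exact Algebra.commutes r y
  | add x z _ _ h₁ h₂ => rw [add_mul, mul_add, h₁, h₂]
  | ι_mul_ι_mul m n x _ h =>
    have key : ι₀ m * ι₀ n * y = y * (ι₀ m * ι₀ n) := by
      rw [mul_assoc, Grass.ι_mul n, ← mul_assoc, Grass.ι_mul m,
        CliffordAlgebra.involute_involute, mul_assoc]
    rw [mul_assoc, h, ← mul_assoc, key, mul_assoc]

theorem Grass.contractLeft_mul (d : Module.Dual ℝ (Fin q → ℝ)) (x y : Grass q) :
    CliffordAlgebra.contractLeft (Q := (0 : QuadraticForm ℝ (Fin q → ℝ))) d (x * y) =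
      CliffordAlgebra.contractLeft (Q := (0 : QuadraticForm ℝ (Fin q → ℝ))) d x * y +
      CliffordAlgebra.involute x *
        CliffordAlgebra.contractLeft (Q := (0 : QuadraticForm ℝ (Fin q → ℝ))) d y := by
  induction x using CliffordAlgebra.left_induction with
  | algebraMap r =>
    rw [CliffordAlgebra.contractLeft_algebraMap_mul, CliffordAlgebra.contractLeft_algebraMap,
      zero_mul, zero_add, AlgHom.commutes]
  | add x z hx hz => simp only [add_mul, map_add, hx, hz]; abel
  | ι_mul x n hx =>
    rw [mul_assoc, CliffordAlgebra.contractLeft_ι_mul, CliffordAlgebra.contractLeft_ι_mul, hx,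
      map_mul, CliffordAlgebra.involute_ι]
    simp only [sub_mul, mul_add, neg_mul, mul_assoc, smul_mul_assoc]
    abel

theorem Grass.contractLeft_involute (d : Module.Dual ℝ (Fin q → ℝ)) (x : Grass q) :
    CliffordAlgebra.contractLeft (Q := (0 : QuadraticForm ℝ (Fin q → ℝ))) d
        (CliffordAlgebra.involute x) =
      -CliffordAlgebra.involute
        (CliffordAlgebra.contractLeft (Q := (0 : QuadraticForm ℝ (Fin q → ℝ))) d x) := by
  induction x using CliffordAlgebra.left_induction with
  | algebraMap r => simp [CliffordAlgebra.contractLeft_algebraMap]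
  | add x z hx hz => simp only [map_add, hx, hz]; abel
  | ι_mul x n hx =>
    rw [map_mul, CliffordAlgebra.involute_ι, neg_mul, map_neg,
      CliffordAlgebra.contractLeft_ι_mul, CliffordAlgebra.contractLeft_ι_mul, hx, map_sub,
      map_smul, map_mul, CliffordAlgebra.involute_ι]
    simp

/-- The augmentation ideal `(θ₁, …, θ_q)` of the Grassmann algebra, as the subspace
`(ℝθ₁ + ⋯ + ℝθ_q) · Λ`. -/
noncomputable def Grass.aug (q : ℕ) : Submodule ℝ (Grass q) :=
  LinearMap.range (ExteriorAlgebra.ι ℝ) * ⊤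

theorem Grass.sub_algebraMapInv_mem_aug (x : Grass q) :
    x - algebraMap ℝ (Grass q) (ExteriorAlgebra.algebraMapInv x) ∈ Grass.aug q := by
  induction x using CliffordAlgebra.left_induction with
  | algebraMap r =>
    have h : ExteriorAlgebra.algebraMapInv (algebraMap ℝ (Grass q) r) = r :=
      ExteriorAlgebra.algebraMap_leftInverse _ r
    rw [h, sub_self]
    exact zero_mem _
  | add x y hx hy =>
    rw [map_add, map_add, add_sub_add_comm]
    exact add_mem hx hy
  | ι_mul x m _ =>
    have h : ExteriorAlgebra.algebraMapInv (ι₀ m * x) = 0 := by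
      rw [map_mul]
      have : ExteriorAlgebra.algebraMapInv (ι₀ m) = (0 : ℝ) := by
        change ExteriorAlgebra.algebraMapInv (ExteriorAlgebra.ι ℝ m) = (0 : ℝ)
        simp [ExteriorAlgebra.algebraMapInv]
      rw [this, zero_mul]
    rw [h, map_zero, sub_zero]
    exact Submodule.mul_mem_mul ⟨m, rfl⟩ Submodule.mem_top

theorem Grass.exteriorPower_succ_eq_bot : (⋀[ℝ]^(q + 1) (Fin q → ℝ)) = ⊥ := by
  rw [← ExteriorAlgebra.ιMulti_span_fixedDegree, Submodule.span_eq_bot]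
  rintro _ ⟨v, rfl⟩
  refine AlternatingMap.map_linearDependent _ v fun h => ?_
  have := h.fintype_card_le_finrank
  simp at this

theorem Grass.aug_pow_eq_bot : Grass.aug q ^ (q + 1) = ⊥ := by
  have hc : Commute (LinearMap.range (ExteriorAlgebra.ι ℝ (M := Fin q → ℝ)))
      (⊤ : Submodule ℝ (Grass q)) := by
    refine le_antisymm (Submodule.mul_le.2 ?_) (Submodule.mul_le.2 ?_)
    · rintro _ ⟨m, rfl⟩ x _
      have := Grass.ι_mul m x
      rw [show ExteriorAlgebra.ι ℝ m * x = _ from this]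
      exact Submodule.mul_mem_mul Submodule.mem_top ⟨m, rfl⟩
    · rintro x _ _ ⟨m, rfl⟩
      have := Grass.ι_mul m (CliffordAlgebra.involute x)
      rw [CliffordAlgebra.involute_involute] at this
      rw [show x * ExteriorAlgebra.ι ℝ m = _ from this.symm]
      exact Submodule.mul_mem_mul ⟨m, rfl⟩ Submodule.mem_top
  have h0 : LinearMap.range (ExteriorAlgebra.ι ℝ (M := Fin q → ℝ)) ^ (q + 1) = ⊥ :=
    Grass.exteriorPower_succ_eq_bot
  rw [Grass.aug, hc.mul_pow, h0, Submodule.bot_mul]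

end Grassmann

section

variable {p q : ℕ} {V : Opens (EuclideanSpace ℝ (Fin p))}

/-! ### Partial derivatives of smooth functions -/

theorem extZero_apply (f : CInf V) (x : V) : extZero f x = f x :=
  Subtype.val_injective.extend_apply _ _ _

theorem partialX_mul (i : Fin p) (f g : CInf V) :
    partialX i (f * g) = partialX i f * g + f * partialX i g := by
  ext x
  have h : extZero (f * g) = extZero f * extZero g := by
    unfold extZero
    rw [← Function.extend_mul, mul_zero]
    rfl
  have hf := (contDiffAt_extZero f x).differentiableAt (by simp)
  have hg := (contDiffAt_extZero g x).differentiableAt (by simp)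
  change fderiv ℝ (extZero (f * g)) x _ =
    fderiv ℝ (extZero f) x _ * g x + f x * fderiv ℝ (extZero g) x _
  rw [h, fderiv_mul hf hg, extZero_apply, extZero_apply]
  simp only [add_apply, smul_apply, smul_eq_mul]
  ring

theorem partialX_exp (i : Fin p) (b : CInf V) :
    partialX i (compReal Real.exp b fun _ => Real.contDiff_exp.contDiffAt) =
      compReal Real.exp b (fun _ => Real.contDiff_exp.contDiffAt) * partialX i b := by
  ext x
  set e := compReal Real.exp b fun _ => Real.contDiff_exp.contDiffAt
  -- The two sides agree on `V` only: elsewhere the left one is `0` and the right one `exp 0`.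
  have h : extZero e =ᶠ[nhds (x : EuclideanSpace ℝ (Fin p))]
      fun y => Real.exp (extZero b y) := by
    filter_upwards [V.isOpen.mem_nhds x.2] with y hy
    rw [extZero_apply e ⟨y, hy⟩, extZero_apply b ⟨y, hy⟩]
    rfl
  have hb := (contDiffAt_extZero b x).differentiableAt (by simp)
  change fderiv ℝ (extZero e) x _ = Real.exp (b x) * fderiv ℝ (extZero b) x _
  rw [h.fderiv_eq, fderiv_exp hb, extZero_apply]
  rfl

end

section

variable {p q : ℕ} {V : Opens (EuclideanSpace ℝ (Fin p))}

/-! ### Signs and partial derivatives of superfunctions -/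

/-- The parity involution as an algebra homomorphism. -/
noncomputable def parityHom : SF q V →ₐ[ℝ] SF q V :=
  Algebra.TensorProduct.map (AlgHom.id ℝ (CInf V))
    (CliffordAlgebra.involute (Q := (0 : QuadraticForm ℝ (Fin q → ℝ))))

theorem parityInv_eq_parityHom (f : SF q V) : parityInv f = parityHom f := by
  induction f using TensorProduct.induction_on with
  | zero => simp
  | tmul b x => rfl
  | add f g hf hg => rw [map_add, map_add, hf, hg]

theorem parityInv_mul (f g : SF q V) : parityInv (f * g) = parityInv f * parityInv g := by
  simp only [parityInv_eq_parityHom, map_mul]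

theorem parityInv_parityInv (f : SF q V) : parityInv (parityInv f) = f := by
  induction f using TensorProduct.induction_on with
  | zero => simp
  | tmul b x => simp [parityInv]
  | add f g hf hg => rw [map_add, map_add, hf, hg]

theorem parityInv_ofFun (b : CInf V) : parityInv (ofFun b : SF q V) = ofFun b := by
  rw [parityInv_eq_parityHom]
  simp [parityHom, ofFun]

theorem twist_cases (k : ZMod 2) :
    (k = 0 ∧ (twist k : Module.End ℝ (SF q V)) = 1) ∨
      (k = 1 ∧ (twist k : Module.End ℝ (SF q V)) = parityInv) := by
  have h : ∀ k : ZMod 2, k = 0 ∨ k = 1 := by decide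
  rcases h k with rfl | rfl
  · exact Or.inl ⟨rfl, pow_zero _⟩
  · exact Or.inr ⟨rfl, pow_one _⟩

theorem twist_mul (k : ZMod 2) (f g : SF q V) : twist k (f * g) = twist k f * twist k g := by
  rcases twist_cases (q := q) (V := V) k with ⟨-, h⟩ | ⟨-, h⟩ <;> rw [h]
  · rfl
  · exact parityInv_mul f g

theorem twist_twist (k : ZMod 2) (f : SF q V) : twist k (twist k f) = f := by
  rcases twist_cases (q := q) (V := V) k with ⟨-, h⟩ | ⟨-, h⟩ <;> rw [h]
  · rfl
  · exact parityInv_parityInv f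

theorem pd_mul (a : Fin p ⊕ Fin q) (f g : SF q V) :
    pd a (f * g) = pd a f * g + twist (par a) f * pd a g := by
  induction f using TensorProduct.induction_on with
  | zero => simp
  | add f₁ f₂ h₁ h₂ => simp only [add_mul, map_add, h₁, h₂]; abel
  | tmul b x =>
    induction g using TensorProduct.induction_on with
    | zero => simp
    | add g₁ g₂ h₁ h₂ => simp only [mul_add, map_add, h₁, h₂]; abel
    | tmul c y =>
      cases a with
      | inl i =>
        have ht : twist (par (Sum.inl i : Fin p ⊕ Fin q)) (b ⊗ₜ[ℝ] x : SF q V) = b ⊗ₜ x := rfl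
        rw [ht]
        simp only [pd, Algebra.TensorProduct.tmul_mul_tmul, LinearMap.rTensor_tmul,
          partialX_mul, TensorProduct.add_tmul]
      | inr j =>
        have ht : twist (par (Sum.inr j : Fin p ⊕ Fin q)) (b ⊗ₜ[ℝ] x : SF q V) =
            b ⊗ₜ CliffordAlgebra.involute x := rfl
        rw [ht]
        simp only [pd, Algebra.TensorProduct.tmul_mul_tmul, LinearMap.lTensor_tmul,
          Grass.contractLeft_mul, TensorProduct.tmul_add]

theorem sgn_zero : sgn 0 = 1 := by simp [sgn]

theorem sgn_one : sgn 1 = -1 := by simp [sgn, ZMod.val_one]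

theorem sgn_mul_self (k : ZMod 2) : sgn k * sgn k = 1 := by
  have h : ∀ k : ZMod 2, k = 0 ∨ k = 1 := by decide
  rcases h k with rfl | rfl <;> simp [sgn_zero, sgn_one]

theorem pd_parityInv (a : Fin p ⊕ Fin q) (f : SF q V) :
    pd a (parityInv f) = sgn (par a) • parityInv (pd a f) := by
  induction f using TensorProduct.induction_on with
  | zero => simp
  | add f g hf hg => simp only [map_add, hf, hg, smul_add]
  | tmul b x =>
    cases a with
    | inl i =>
      change (partialX i b) ⊗ₜ[ℝ] _ = sgn 0 • ((partialX i b) ⊗ₜ[ℝ] _)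
      rw [sgn_zero, one_smul]
      rfl
    | inr j =>
      change b ⊗ₜ[ℝ] _ = sgn 1 • (b ⊗ₜ[ℝ] _)
      rw [sgn_one, ← TensorProduct.tmul_smul]
      refine congrArg (b ⊗ₜ[ℝ] ·) ((Grass.contractLeft_involute _ x).trans ?_)
      exact (neg_one_smul ℝ _).symm

theorem twist_pd_twist (a b : Fin p ⊕ Fin q) (f : SF q V) :
    twist (par a) (pd b (twist (par a) f)) = sgn (par a * par b) • pd b f := by
  rcases twist_cases (q := q) (V := V) (par a) with ⟨h, ht⟩ | ⟨h, ht⟩ <;> rw [ht, h]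
  · rw [zero_mul, sgn_zero, one_smul]
    rfl
  · rw [pd_parityInv, map_smul, parityInv_parityInv, one_mul]

/-! ### Even superfunctions -/

variable (q V) in
/-- The central superfunctions that are fixed by the parity involution. All even superfunctions
are of this kind, and the calculus of even superfunctions uses nothing else about them. -/
noncomputable def evenPart : Subalgebra ℝ (SF q V) :=
  Subalgebra.center ℝ (SF q V) ⊓ AlgHom.equalizer parityHom (AlgHom.id ℝ (SF q V))

theorem mem_evenPart {u : SF q V} :
    u ∈ evenPart q V ↔ (∀ f, f * u = u * f) ∧ parityInv u = u := by
  rw [parityInv_eq_parityHom]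
  exact and_congr Subalgebra.mem_center_iff Iff.rfl

theorem evenPart_comm {u : SF q V} (hu : u ∈ evenPart q V) (f : SF q V) : f * u = u * f :=
  (mem_evenPart.1 hu).1 f

theorem twist_of_mem_evenPart {u : SF q V} (hu : u ∈ evenPart q V) (k : ZMod 2) :
    twist k u = u := by
  rcases twist_cases (q := q) (V := V) k with ⟨-, h⟩ | ⟨-, h⟩ <;> rw [h]
  · rfl
  · exact (mem_evenPart.1 hu).2

theorem ofFun_comm (b : CInf V) (f : SF q V) : f * ofFun b = ofFun b * f := by
  induction f using TensorProduct.induction_on with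
  | zero => simp
  | add f g hf hg => rw [add_mul, mul_add, hf, hg]
  | tmul c x => simp [ofFun, mul_comm]

theorem ofFun_mem_evenPart (b : CInf V) : (ofFun b : SF q V) ∈ evenPart q V :=
  mem_evenPart.2 ⟨ofFun_comm b, parityInv_ofFun b⟩

theorem homog_zero_le_evenPart : homog q V 0 ≤ Subalgebra.toSubmodule (evenPart q V) := by
  rintro _ ⟨f, rfl⟩
  induction f using TensorProduct.induction_on with
  | zero => rw [map_zero]; exact zero_mem _
  | add f g hf hg => rw [map_add]; exact add_mem hf hg
  | tmul b x =>
    refine mem_evenPart.2 ⟨fun g => ?_, ?_⟩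
    · induction g using TensorProduct.induction_on with
      | zero => simp
      | add f g hf hg => rw [add_mul, mul_add, hf, hg]
      | tmul c y =>
        simp only [LinearMap.lTensor_tmul, Submodule.subtype_apply,
          Algebra.TensorProduct.tmul_mul_tmul]
        rw [mul_comm c b, Grass.even_comm x.2 y]
    · exact congrArg (b ⊗ₜ[ℝ] ·) (CliffordAlgebra.involute_eq_of_mem_even x.2)

theorem inverse_mem_evenPart {u : SF q V} (hu : u ∈ evenPart q V) :
    Ring.inverse u ∈ evenPart q V := by
  by_cases h : IsUnit u
  · obtain ⟨w, rfl⟩ := h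
    rw [Ring.inverse_unit]
    refine mem_evenPart.2 ⟨fun f => ?_, ?_⟩
    · rw [Units.mul_inv_eq_iff_eq_mul, mul_assoc, evenPart_comm hu f, Units.inv_mul_cancel_left]
    · rw [← Units.mul_right_inj w]
      calc (w : SF q V) * parityInv ((w⁻¹ : (SF q V)ˣ) : SF q V)
          = parityInv ((w : SF q V) * ((w⁻¹ : (SF q V)ˣ) : SF q V)) := by
            rw [parityInv_mul, (mem_evenPart.1 hu).2]
        _ = w * ((w⁻¹ : (SF q V)ˣ) : SF q V) := by
            rw [Units.mul_inv, parityInv_eq_parityHom, map_one]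
  · rw [Ring.inverse_non_unit _ h]
    exact zero_mem _

/-- An even function commutes with its derivatives up to the sign of the derivative: this is the
Leibniz rule applied to both sides of `u f = f u`. -/
theorem pd_mul_eq_twist_mul_pd {u : SF q V} (hu : u ∈ evenPart q V) (a : Fin p ⊕ Fin q)
    (f : SF q V) : pd a u * f = twist (par a) f * pd a u := by
  have h := congrArg (pd a) (evenPart_comm hu f)
  rw [pd_mul, pd_mul, twist_of_mem_evenPart hu, evenPart_comm hu, add_comm] at h
  exact (add_right_cancel h).symm

theorem pd_pow {u : SF q V} (hu : u ∈ evenPart q V) (a : Fin p ⊕ Fin q) (k : ℕ) :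
    pd a (u ^ k) = (k : ℝ) • (u ^ (k - 1) * pd a u) := by
  induction k with
  | zero =>
    have h := pd_mul a (1 : SF q V) 1
    rw [mul_one, mul_one, twist_of_mem_evenPart (one_mem _), one_mul] at h
    rw [pow_zero, left_eq_add.1 h, Nat.cast_zero, zero_smul]
  | succ k ih =>
    rw [pow_succ', pd_mul, twist_of_mem_evenPart hu, ih, pd_mul_eq_twist_mul_pd hu,
      twist_of_mem_evenPart (pow_mem hu k), mul_smul_comm, Nat.cast_succ, add_smul, one_smul,
      Nat.add_sub_cancel, add_comm]
    congr 1
    cases k with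
    | zero => simp
    | succ k => rw [Nat.add_sub_cancel, ← mul_assoc, ← pow_succ']

/-! ### Nilpotent superfunctions -/

theorem body_ofFun (b : CInf V) : body (ofFun b : SF q V) = b := by
  simp [body, ofFun]

theorem pow_eq_zero_of_mem_mul_of_pow_eq_bot {A : Type*} [Ring A] [Algebra ℝ A]
    {C T : Submodule ℝ A} (hc : ∀ c ∈ C, ∀ t ∈ T, t * c = c * t) {k : ℕ} (hT : T ^ k = ⊥)
    {f : A} (hf : f ∈ C * T) : f ^ k = 0 := by
  have hCT : Commute C T := by
    refine le_antisymm (Submodule.mul_le.2 fun c h t h' => ?_)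
      (Submodule.mul_le.2 fun t h' c h => ?_)
    · exact hc c h t h' ▸ Submodule.mul_mem_mul h' h
    · exact (hc c h t h').symm ▸ Submodule.mul_mem_mul h h'
  have h := Submodule.pow_mem_pow (C * T) hf k
  rwa [hCT.mul_pow, hT, Submodule.mul_bot, Submodule.mem_bot] at h

/-- The kernel of `body` is spanned by the products `ofFun b * (1 ⊗ₜ x)` with `x` in the
augmentation ideal. The factors `ofFun b` are central, so the power of the kernel vanishes with
that of the augmentation ideal. -/
theorem pow_succ_eq_zero_of_body_eq_zero {n : SF q V} (hn : body n = 0) : n ^ (q + 1) = 0 := by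
  let C : Submodule ℝ (SF q V) :=
    (⊤ : Submodule ℝ (CInf V)).map
      (Algebra.TensorProduct.includeLeft : CInf V →ₐ[ℝ] SF q V).toLinearMap
  let T : Submodule ℝ (SF q V) :=
    (Grass.aug q).map (Algebra.TensorProduct.includeRight : Grass q →ₐ[ℝ] SF q V).toLinearMap
  have hmem : ∀ f : SF q V, f - ofFun (body f) ∈ C * T := by
    intro f
    induction f using TensorProduct.induction_on with
    | zero => simp [ofFun]
    | add f g hf hg =>
      have : f + g - ofFun (body (f + g)) =
          (f - ofFun (body f)) + (g - ofFun (body g)) := by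
        rw [map_add, ofFun, TensorProduct.add_tmul, ← ofFun, ← ofFun]
        abel
      rw [this]
      exact add_mem hf hg
    | tmul b x =>
      have : (b ⊗ₜ[ℝ] x : SF q V) - ofFun (body (b ⊗ₜ[ℝ] x)) =
          Algebra.TensorProduct.includeLeft (S := ℝ) b * Algebra.TensorProduct.includeRight
            (x - algebraMap ℝ (Grass q) (ExteriorAlgebra.algebraMapInv x)) := by
        simp only [body, ofFun, AlgHom.comp_apply, Algebra.TensorProduct.map_tmul,
          AlgHom.id_apply, Algebra.algebraMap_eq_smul_one,
          Algebra.TensorProduct.includeLeft_apply, Algebra.TensorProduct.includeRight_apply,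
          TensorProduct.tmul_sub, TensorProduct.tmul_smul, TensorProduct.smul_tmul', mul_sub,
          mul_smul_comm, Algebra.TensorProduct.tmul_mul_tmul, mul_one, one_mul]
        rfl
      rw [this]
      exact Submodule.mul_mem_mul ⟨b, trivial, rfl⟩
        ⟨_, Grass.sub_algebraMapInv_mem_aug x, rfl⟩
  have h := pow_eq_zero_of_mem_mul_of_pow_eq_bot (C := C) (T := T)
    (by rintro _ ⟨b, _, rfl⟩ x _; exact ofFun_comm b x)
    (by rw [← Submodule.map_pow, Grass.aug_pow_eq_bot, Submodule.map_bot]) (hmem n)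
  rwa [hn, ofFun, TensorProduct.zero_tmul, sub_zero] at h

theorem ofFun_mul (b c : CInf V) : (ofFun (b * c) : SF q V) = ofFun b * ofFun c := by
  simp [ofFun]

theorem isUnit_ofFun {b : CInf V} (hb : IsUnit b) : IsUnit (ofFun b : SF q V) :=
  hb.map (Algebra.TensorProduct.includeLeft : CInf V →ₐ[ℝ] SF q V)

theorem isUnit_iff_body {f : SF q V} : IsUnit f ↔ IsUnit (body f) := by
  refine ⟨fun h => h.map body, fun h => ?_⟩
  have h₂ : IsNilpotent (f - ofFun (body f)) :=
    ⟨q + 1, pow_succ_eq_zero_of_body_eq_zero (by rw [map_sub, body_ofFun, sub_self])⟩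
  have h₃ := h₂.isUnit_add_left_of_commute (isUnit_ofFun h) (ofFun_comm _ _)
  rwa [add_sub_cancel] at h₃

end

/-! ### Power series at nilpotent elements -/

section NilEval

variable {A : Type*} [Ring A] [Algebra ℝ A]

/-- The value of a power series at an element `n`, cut off at the `N`-th power. It is the value
of the whole series if `n ^ N = 0`. -/
noncomputable def nilEval (N : ℕ) (n : A) (φ : PowerSeries ℝ) : A :=
  ∑ k ∈ Finset.range N, PowerSeries.coeff k φ • n ^ k

theorem nilEval_eq_aeval_trunc (N : ℕ) (n : A) (φ : PowerSeries ℝ) :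
    nilEval N n φ = Polynomial.aeval n (PowerSeries.trunc N φ) := by
  rw [Polynomial.aeval_def, PowerSeries.eval₂_trunc_eq_sum_range]
  exact Finset.sum_congr rfl fun k _ => Algebra.smul_def _ _

theorem nilEval_coe {N : ℕ} {n : A} (hn : n ^ N = 0) (P : Polynomial ℝ) :
    nilEval N n (P : PowerSeries ℝ) = Polynomial.aeval n P := by
  rw [nilEval_eq_aeval_trunc]
  have h : (Polynomial.X : Polynomial ℝ) ^ N ∣ P - PowerSeries.trunc N (P : PowerSeries ℝ) := by
    rw [Polynomial.X_pow_dvd_iff]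
    intro d hd
    rw [Polynomial.coeff_sub, PowerSeries.coeff_trunc, if_pos hd, Polynomial.coeff_coe, sub_self]
  obtain ⟨Q, hQ⟩ := h
  have := congrArg (Polynomial.aeval n) hQ
  rw [map_sub, map_mul, map_pow, Polynomial.aeval_X, hn, zero_mul] at this
  exact (sub_eq_zero.1 this).symm

theorem nilEval_mul {N : ℕ} {n : A} (hn : n ^ N = 0) (φ ψ : PowerSeries ℝ) :
    nilEval N n (φ * ψ) = nilEval N n φ * nilEval N n ψ := by
  rw [nilEval_eq_aeval_trunc, ← PowerSeries.trunc_trunc_mul_trunc, ← Polynomial.coe_mul,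
    ← nilEval_eq_aeval_trunc, nilEval_coe hn, map_mul, ← nilEval_eq_aeval_trunc,
    ← nilEval_eq_aeval_trunc]

end NilEval

section

variable {p q : ℕ} {V : Opens (EuclideanSpace ℝ (Fin p))}

theorem nilEval_mem_evenPart (N : ℕ) {n : SF q V} (hn : n ∈ evenPart q V) (φ : PowerSeries ℝ) :
    nilEval N n φ ∈ evenPart q V :=
  Subalgebra.sum_mem _ fun k _ => Subalgebra.smul_mem _ (pow_mem hn k) _

theorem body_nilEval {n : SF q V} (hn : body n = 0) (φ : PowerSeries ℝ) :
    body (nilEval (q + 1) n φ) = algebraMap ℝ _ (PowerSeries.constantCoeff φ) := by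
  rw [nilEval, map_sum, Finset.sum_eq_single 0]
  · rw [pow_zero, map_smul, map_one, Algebra.algebraMap_eq_smul_one,
      PowerSeries.coeff_zero_eq_constantCoeff_apply]
  · intro k _ hk
    rw [map_smul, map_pow, hn, zero_pow hk, smul_zero]
  · simp

/-! ### Exponentials -/

theorem superExp_eq_nilEval (f : SF q V) :
    superExp f = ofFun (compReal Real.exp (body f) fun _ => Real.contDiff_exp.contDiffAt) *
      nilEval (q + 1) (f - ofFun (body f)) (PowerSeries.exp ℝ) := by
  rw [superExp, nilEval]
  congr 1
  refine Finset.sum_congr rfl fun k _ => ?_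
  simp [PowerSeries.coeff_exp]

theorem ofFun_smul (t : ℝ) (b : CInf V) : (ofFun (t • b) : SF q V) = t • ofFun b :=
  (TensorProduct.smul_tmul' t b 1).symm

theorem superExp_smul_eq_nilEval (t : ℝ) (f : SF q V) :
    superExp (t • f) =
      ofFun (compReal Real.exp (t • body f) fun _ => Real.contDiff_exp.contDiffAt) *
        nilEval (q + 1) (f - ofFun (body f))
          (PowerSeries.rescale t (PowerSeries.exp ℝ)) := by
  have h : t • f - t • ofFun (body f) = t • (f - ofFun (body f)) := (smul_sub _ _ _).symm
  rw [superExp_eq_nilEval, map_smul, ofFun_smul, h, nilEval, nilEval]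
  congr 1
  refine Finset.sum_congr rfl fun k _ => ?_
  rw [PowerSeries.coeff_rescale, mul_comm, mul_smul]
  congr 1
  exact smul_pow _ _ _

theorem body_sub_ofFun_body (f : SF q V) : body (f - ofFun (body f)) = 0 := by
  rw [map_sub, body_ofFun, sub_self]

theorem superExp_smul_mul_superExp_smul (s t : ℝ) (f : SF q V) :
    superExp (s • f) * superExp (t • f) = superExp ((s + t) • f) := by
  simp only [superExp_smul_eq_nilEval]
  rw [← PowerSeries.exp_mul_exp_eq_exp_add,
    nilEval_mul (pow_succ_eq_zero_of_body_eq_zero (body_sub_ofFun_body f))]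
  have h : compReal Real.exp ((s + t) • body f) (fun _ => Real.contDiff_exp.contDiffAt) =
      compReal Real.exp (s • body f) (fun _ => Real.contDiff_exp.contDiffAt) *
        compReal Real.exp (t • body f) (fun _ => Real.contDiff_exp.contDiffAt) := by
    ext x
    change Real.exp ((s + t) * body f x) = Real.exp (s * body f x) * Real.exp (t * body f x)
    rw [add_mul, Real.exp_add]
  rw [h, ofFun_mul, mul_assoc, mul_assoc]
  congr 1
  rw [← mul_assoc, ofFun_comm, mul_assoc]

theorem superExp_zero : superExp (0 : SF q V) = 1 := by
  have h : compReal Real.exp (body (0 : SF q V)) (fun _ => Real.contDiff_exp.contDiffAt) = 1 := by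
    ext x
    change Real.exp (body (0 : SF q V) x) = 1
    rw [map_zero]
    exact Real.exp_zero
  have h₀ : (ofFun 1 : SF q V) = 1 := rfl
  have h₁ : (ofFun 0 : SF q V) = 0 := TensorProduct.zero_tmul _ _
  rw [superExp, h, map_zero, h₁, h₀, sub_zero, one_mul, Finset.sum_eq_single 0]
  · simp
  · intro k _ hk
    rw [zero_pow hk, smul_zero]
  · simp

theorem superExp_neg_smul_mul (t : ℝ) (f : SF q V) :
    superExp (-t • f) * superExp (t • f) = 1 := by
  rw [superExp_smul_mul_superExp_smul, neg_add_cancel, zero_smul, superExp_zero]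

theorem superExp_mem_evenPart {f : SF q V} (hf : f ∈ evenPart q V) :
    superExp f ∈ evenPart q V := by
  rw [superExp_eq_nilEval]
  exact mul_mem (ofFun_mem_evenPart _)
    (nilEval_mem_evenPart _ (sub_mem hf (ofFun_mem_evenPart _)) _)

theorem body_superExp (f : SF q V) :
    body (superExp f) =
      compReal Real.exp (body f) fun _ => Real.contDiff_exp.contDiffAt := by
  rw [superExp_eq_nilEval, map_mul, body_ofFun, body_nilEval (body_sub_ofFun_body f)]
  simp

theorem isUnit_superExp (f : SF q V) : IsUnit (superExp f) := by
  rw [isUnit_iff_body, body_superExp]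
  refine IsUnit.of_mul_eq_one
    (compReal Real.exp (-body f) fun _ => Real.contDiff_exp.contDiffAt) ?_
  ext x
  change Real.exp (body f x) * Real.exp (-(body f x)) = 1
  rw [← Real.exp_add, add_neg_cancel, Real.exp_zero]

theorem pd_ofFun_exp (a : Fin p ⊕ Fin q) (b : CInf V) :
    pd a (ofFun (compReal Real.exp b fun _ => Real.contDiff_exp.contDiffAt) : SF q V) =
      ofFun (compReal Real.exp b fun _ => Real.contDiff_exp.contDiffAt) * pd a (ofFun b) := by
  cases a with
  | inl i =>
    change (partialX i _) ⊗ₜ[ℝ] _ = _ ⊗ₜ[ℝ] 1 * (partialX i b) ⊗ₜ[ℝ] _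
    rw [partialX_exp, Algebra.TensorProduct.tmul_mul_tmul, one_mul]
  | inr j => simp [pd, ofFun, CliffordAlgebra.contractLeft_one]

/-- The derivative lowers the degree of the truncated exponential series by one. The missing
top term is no loss, because `(q + 1) n ^ q ∂n = ∂(n ^ (q + 1)) = 0`. -/
theorem pd_nilEval_exp {n : SF q V} (hn : n ∈ evenPart q V) (h0 : body n = 0)
    (a : Fin p ⊕ Fin q) :
    pd a (nilEval (q + 1) n (PowerSeries.exp ℝ)) =
      nilEval (q + 1) n (PowerSeries.exp ℝ) * pd a n := by
  have htop : n ^ q * pd a n = 0 := by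
    have h := pd_pow hn a (q + 1)
    rw [pow_succ_eq_zero_of_body_eq_zero h0, map_zero, Nat.add_sub_cancel] at h
    exact (smul_eq_zero.1 h.symm).resolve_left (by positivity)
  have hc : ∀ k, PowerSeries.coeff k (PowerSeries.exp ℝ) = ((k.factorial : ℝ))⁻¹ := by
    simp [PowerSeries.coeff_exp]
  simp only [nilEval, hc]
  rw [map_sum, Finset.sum_range_succ', Finset.sum_range_succ, add_mul, smul_mul_assoc, htop,
    smul_zero, add_zero, pow_zero, map_smul]
  have h1 : pd a (1 : SF q V) = 0 := by simpa using pd_pow hn a 0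
  rw [h1, smul_zero, add_zero, Finset.sum_mul]
  refine Finset.sum_congr rfl fun k _ => ?_
  rw [map_smul, pd_pow hn, smul_smul, Nat.add_sub_cancel, smul_mul_assoc, Nat.factorial_succ]
  congr 1
  push_cast
  field_simp

theorem pd_superExp {f : SF q V} (hf : f ∈ evenPart q V) (a : Fin p ⊕ Fin q) :
    pd a (superExp f) = superExp f * pd a f := by
  have hb := ofFun_mem_evenPart (q := q) (body f)
  have he := ofFun_mem_evenPart (q := q)
    (compReal Real.exp (body f) fun _ => Real.contDiff_exp.contDiffAt)
  have hN := nilEval_mem_evenPart (q + 1) (sub_mem hf hb) (PowerSeries.exp ℝ)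
  rw [superExp_eq_nilEval, pd_mul, pd_ofFun_exp, twist_of_mem_evenPart he,
    pd_nilEval_exp (sub_mem hf hb) (body_sub_ofFun_body f), map_sub, mul_assoc,
    evenPart_comm hN, ← mul_assoc, ← mul_assoc, ← mul_add]
  congr 1
  abel

/-! ### Square roots -/

theorem ne_zero_of_isUnit {b : CInf V} (hb : IsUnit b) (x : V) : b x ≠ 0 := by
  obtain ⟨c, hc⟩ := hb.exists_right_inv
  intro h
  have h₁ : b x * c x = 1 := congrArg (fun f : CInf V => f x) hc
  rw [h, zero_mul] at h₁
  exact zero_ne_one h₁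

theorem isUnit_of_ne_zero {b : CInf V} (hb : ∀ x, b x ≠ 0) : IsUnit b := by
  refine IsUnit.of_mul_eq_one (compReal (fun t => t⁻¹) b fun x => contDiffAt_inv ℝ (hb x)) ?_
  ext x
  exact mul_inv_cancel₀ (hb x)

variable {f : SF q V}

theorem absPow_eq_nilEval (w : ℝ) (h : ∀ x, body f x ≠ 0) :
    absPow w f =
      ofFun (compReal (fun t => |t| ^ w) (body f) fun x => contDiffAt_abs_rpow w (h x)) *
        nilEval (q + 1) (Ring.inverse (ofFun (body f)) * f - 1)
          (PowerSeries.binomialSeries ℝ w) := by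
  rw [absPow, dif_pos h, nilEval]
  simp

theorem body_inverse_mul_sub_one (h : IsUnit f) :
    body (Ring.inverse (ofFun (body f)) * f - 1) = 0 := by
  have h₁ := isUnit_iff_body.1 h
  have h₂ := congrArg body (Ring.inverse_mul_cancel _ (isUnit_ofFun (q := q) h₁))
  rw [map_mul, body_ofFun] at h₂
  rw [map_sub, map_mul, h₂, sub_self]

theorem body_absPow (w : ℝ) (hf : IsUnit f) (x : V) : body (absPow w f) x = |body f x| ^ w := by
  have h := ne_zero_of_isUnit (isUnit_iff_body.1 hf)
  rw [absPow_eq_nilEval w h, map_mul, body_ofFun, body_nilEval (body_inverse_mul_sub_one hf),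
    PowerSeries.binomialSeries_constantCoeff, map_one, mul_one]
  rfl

theorem absPow_mem_evenPart (w : ℝ) (hf : f ∈ evenPart q V) : absPow w f ∈ evenPart q V := by
  by_cases h : ∀ x, body f x ≠ 0
  · rw [absPow_eq_nilEval w h]
    exact mul_mem (ofFun_mem_evenPart _) (nilEval_mem_evenPart _ (sub_mem
      (mul_mem (inverse_mem_evenPart (ofFun_mem_evenPart _)) hf) (one_mem _)) _)
  · rw [absPow, dif_neg h]
    exact zero_mem _

theorem isUnit_absPow (w : ℝ) (hf : IsUnit f) : IsUnit (absPow w f) := by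
  rw [isUnit_iff_body]
  refine isUnit_of_ne_zero fun x => ?_
  rw [body_absPow w hf]
  exact (Real.rpow_pos_of_pos
    (abs_pos.2 (ne_zero_of_isUnit (isUnit_iff_body.1 hf) x)) w).ne'

/-- The square of `|f|^{1/2}` is `|f| = (|b| / b) f`, with `b` the body of `f`. -/
theorem absPow_half_mul_self (hf : IsUnit f) {c : CInf V} (hc : ∀ x, c x = |body f x|) :
    ofFun (body f) * (absPow (1 / 2) f * absPow (1 / 2) f) = ofFun c * f := by
  have hb := isUnit_iff_body.1 hf
  have h := ne_zero_of_isUnit hb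
  have hnil := pow_succ_eq_zero_of_body_eq_zero (body_inverse_mul_sub_one hf)
  have hsq : ∀ n : SF q V, n ^ (q + 1) = 0 →
      nilEval (q + 1) n (PowerSeries.binomialSeries ℝ (1 / 2 : ℝ)) *
        nilEval (q + 1) n (PowerSeries.binomialSeries ℝ (1 / 2 : ℝ)) = 1 + n := by
    intro n hn
    have h₁ : (PowerSeries.binomialSeries ℝ (1 : ℝ)) =
        ((1 + Polynomial.X : Polynomial ℝ) : PowerSeries ℝ) := by
      simpa using PowerSeries.binomialSeries_nat (R := ℝ) (A := ℝ) 1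
    rw [← nilEval_mul hn, ← PowerSeries.binomialSeries_add, add_halves, h₁, nilEval_coe hn,
      map_add, map_one, Polynomial.aeval_X]
  set B : CInf V :=
    compReal (fun t => |t| ^ (1 / 2 : ℝ)) (body f) fun x => contDiffAt_abs_rpow _ (h x) with hB
  have hBB : B * B = c := by
    ext x
    change |body f x| ^ (1 / 2 : ℝ) * |body f x| ^ (1 / 2 : ℝ) = c x
    rw [hc, ← Real.rpow_add (abs_pos.2 (h x)), add_halves, Real.rpow_one]
  rw [absPow_eq_nilEval _ h, ← hB]
  rw [Commute.mul_mul_mul_comm (ofFun_comm B _), hsq _ hnil, add_sub_cancel, ← ofFun_mul, hBB,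
    ← mul_assoc, ofFun_comm c (ofFun (body f)), mul_assoc, ← mul_assoc (ofFun (body f)),
    Ring.mul_inverse_cancel _ (isUnit_ofFun hb), one_mul]

/-- Both sides have the same square and a positive body. Hence their difference is annihilated
by their sum, which is invertible. -/
theorem absPow_half_superExp_mul {σ : SF q V} (hσ : σ ∈ evenPart q V) (hf : f ∈ evenPart q V)
    (hu : IsUnit f) :
    absPow (1 / 2) (superExp σ * f) = superExp ((1 / 2 : ℝ) • σ) * absPow (1 / 2) f := by
  have hu' : IsUnit (superExp σ * f) := (isUnit_superExp σ).mul hu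
  have hσ' : (1 / 2 : ℝ) • σ ∈ evenPart q V := Subalgebra.smul_mem _ hσ _
  have hb := ne_zero_of_isUnit (isUnit_iff_body.1 hu)
  let c : CInf V := compReal (fun t => |t|) (body f) fun x => contDiffAt_abs (hb x)
  let e : CInf V := compReal Real.exp (body σ) fun _ => Real.contDiff_exp.contDiffAt
  have hbody : body (superExp σ * f) = e * body f := by rw [map_mul, body_superExp]
  have hec : ∀ x, (e * c) x = |body (superExp σ * f) x| := by
    intro x
    rw [hbody]
    change Real.exp (body σ x) * |body f x| = |Real.exp (body σ x) * body f x|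
    rw [abs_mul, Real.abs_exp]
  have h₁ := absPow_half_mul_self hu' hec
  have h₂ := absPow_half_mul_self hu (c := c) fun _ => rfl
  have hw := superExp_mem_evenPart hσ'
  have hww : superExp ((1 / 2 : ℝ) • σ) * superExp ((1 / 2 : ℝ) • σ) = superExp σ := by
    rw [superExp_smul_mul_superExp_smul, add_halves, one_smul]
  set w := superExp ((1 / 2 : ℝ) • σ) with hwdef
  set r := absPow (1 / 2) f with hr
  set r' := absPow (1 / 2) (superExp σ * f) with hr'
  have hr'E : r' ∈ evenPart q V :=
    absPow_mem_evenPart _ (mul_mem (superExp_mem_evenPart hσ) hf)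
  have hsq : r' * r' = w * r * (w * r) := by
    refine (isUnit_ofFun (isUnit_iff_body.1 hu')).mul_left_cancel ?_
    calc _ = ofFun (e * c) * (superExp σ * f) := h₁
      _ = ofFun e * (superExp σ * (ofFun c * f)) := by
        rw [ofFun_mul, mul_assoc, ← mul_assoc (ofFun c), ← ofFun_comm c, mul_assoc]
      _ = ofFun e * (w * w * (ofFun (body f) * (r * r))) := by rw [h₂, hww]
      _ = ofFun (body (superExp σ * f)) * (w * w * (r * r)) := by
        rw [hbody, ofFun_mul, ← mul_assoc (w * w), ofFun_comm]
        simp only [mul_assoc]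
      _ = _ := by rw [Commute.mul_mul_mul_comm (evenPart_comm hw r)]
  have hunit : IsUnit (r' + w * r) := by
    rw [isUnit_iff_body]
    refine isUnit_of_ne_zero fun x => ?_
    have hx : body (r' + w * r) x = body r' x + body w x * body r x := by
      rw [map_add, map_mul]; rfl
    have hwx : body w x = Real.exp (body ((1 / 2 : ℝ) • σ) x) := by
      rw [hwdef, body_superExp]; rfl
    have hbx := hb x
    have hbx' := ne_zero_of_isUnit (isUnit_iff_body.1 hu') x
    rw [hx, hwx, hr, hr', body_absPow _ hu, body_absPow _ hu']
    positivity
  have hz : (r' - w * r) * (r' + w * r) = 0 := by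
    rw [sub_mul, mul_add, mul_add, hsq, evenPart_comm hr'E (w * r)]
    abel
  exact sub_eq_zero.1 ((hunit.mul_left_eq_zero).1 hz)

end

section

variable {p q : ℕ} {V : Opens (EuclideanSpace ℝ (Fin p))}

/-! ### The Laplacian on functions as a second-order operator -/

/-- The twisted components `(-1)^{ã (X̃_f + 1)} X_fᵃ` of the Hamiltonian vector field of `f`. -/
noncomputable def hamTwist (S : Fin p ⊕ Fin q → Fin p ⊕ Fin q → SF q V) (a : Fin p ⊕ Fin q)
    (f : SF q V) : SF q V :=
  twist (par a) (∑ b, S a b * pd b (twist (par a) f))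

/-- The Laplacian `ρ⁻¹ ∑ ± ∂_a (ρ X_fᵃ)` in a superdomain, for the volume form `ρ Dx`. -/
noncomputable def lapOf (S : Fin p ⊕ Fin q → Fin p ⊕ Fin q → SF q V) (ρ f : SF q V) : SF q V :=
  Ring.inverse ρ * ∑ a, pd a (ρ * hamTwist S a f)

/-- The bilinear form `∑ 𝔖ᵃᵇ ∂_b f ∂_a g` of `𝔖`. For even `f` it is `-{f, g}`. -/
noncomputable def symbolForm (S : Fin p ⊕ Fin q → Fin p ⊕ Fin q → SF q V) (f g : SF q V) :
    SF q V :=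
  ∑ a, ∑ b, S a b * pd b f * pd a g

variable {S : Fin p ⊕ Fin q → Fin p ⊕ Fin q → SF q V} {ρ u f : SF q V}

theorem bracketOf_eq_neg_symbolForm (hu : u ∈ evenPart q V) (f : SF q V) :
    SuperManifold.bracketOf S u f = -symbolForm S u f := by
  simp only [SuperManifold.bracketOf, symbolForm, twist_of_mem_evenPart hu]

theorem symbolForm_smul_left (t : ℝ) (f g : SF q V) :
    symbolForm S (t • f) g = t • symbolForm S f g := by
  simp only [symbolForm, map_smul, mul_smul_comm, smul_mul_assoc, Finset.smul_sum]

theorem symbolForm_smul_right (t : ℝ) (f g : SF q V) :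
    symbolForm S f (t • g) = t • symbolForm S f g := by
  simp only [symbolForm, map_smul, mul_smul_comm, Finset.smul_sum]

theorem symbolForm_mul_right (hu : u ∈ evenPart q V) (f g : SF q V) :
    symbolForm S f (u * g) = u * symbolForm S f g + symbolForm S f u * g := by
  simp only [symbolForm, Finset.mul_sum, Finset.sum_mul, ← Finset.sum_add_distrib]
  refine Finset.sum_congr rfl fun a _ => Finset.sum_congr rfl fun b _ => ?_
  rw [pd_mul, twist_of_mem_evenPart hu, mul_add, ← mul_assoc, ← mul_assoc, evenPart_comm hu,
    mul_assoc u, add_comm]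

theorem symbolForm_superExp_left (hu : u ∈ evenPart q V) (f : SF q V) :
    symbolForm S (superExp u) f = superExp u * symbolForm S u f := by
  simp only [symbolForm, Finset.mul_sum]
  refine Finset.sum_congr rfl fun a _ => Finset.sum_congr rfl fun b _ => ?_
  rw [pd_superExp hu, ← mul_assoc, evenPart_comm (superExp_mem_evenPart hu)]
  simp only [mul_assoc]

theorem symbolForm_superExp_right (hu : u ∈ evenPart q V) (f : SF q V) :
    symbolForm S f (superExp u) = superExp u * symbolForm S f u := by
  simp only [symbolForm, Finset.mul_sum]
  refine Finset.sum_congr rfl fun a _ => Finset.sum_congr rfl fun b _ => ?_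
  rw [pd_superExp hu, ← mul_assoc, evenPart_comm (superExp_mem_evenPart hu)]
  simp only [mul_assoc]

theorem twist_hamTwist (hu : u ∈ evenPart q V) (a : Fin p ⊕ Fin q) :
    twist (par a) (hamTwist S a u) = ∑ b, S a b * pd b u := by
  rw [hamTwist, twist_twist, twist_of_mem_evenPart hu]

theorem hamTwist_mul (hu : u ∈ evenPart q V) (a : Fin p ⊕ Fin q) (f : SF q V) :
    hamTwist S a (u * f) = u * hamTwist S a f + hamTwist S a u * f := by
  have h : ∑ b, S a b * pd b (twist (par a) (u * f)) =
      u * ∑ b, S a b * pd b (twist (par a) f) +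
        (∑ b, S a b * pd b (twist (par a) u)) * twist (par a) f := by
    simp only [Finset.mul_sum, Finset.sum_mul, ← Finset.sum_add_distrib]
    refine Finset.sum_congr rfl fun b _ => ?_
    rw [twist_mul, twist_of_mem_evenPart hu, pd_mul, twist_of_mem_evenPart hu, mul_add,
      ← mul_assoc, ← mul_assoc, evenPart_comm hu, mul_assoc u, add_comm]
  rw [hamTwist, h, map_add, twist_mul, twist_mul, twist_twist, hamTwist, hamTwist]
  simp only [twist_of_mem_evenPart hu]

theorem hamTwist_superExp (hu : u ∈ evenPart q V) (a : Fin p ⊕ Fin q) :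
    hamTwist S a (superExp u) = superExp u * hamTwist S a u := by
  have he := superExp_mem_evenPart hu
  have h : ∑ b, S a b * pd b (superExp u) = superExp u * ∑ b, S a b * pd b u := by
    rw [Finset.mul_sum]
    refine Finset.sum_congr rfl fun b _ => ?_
    rw [pd_superExp hu, ← mul_assoc, evenPart_comm he, mul_assoc]
  rw [hamTwist, twist_of_mem_evenPart he, h, twist_mul, twist_of_mem_evenPart he, hamTwist,
    twist_of_mem_evenPart hu]

theorem hamTwist_smul (t : ℝ) (a : Fin p ⊕ Fin q) (f : SF q V) :
    hamTwist S a (t • f) = t • hamTwist S a f := by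
  simp only [hamTwist, map_smul, mul_smul_comm, ← Finset.smul_sum]

/-- The derivative of `f` along the Hamiltonian vector field of an even `u` equals the derivative
of `u` along that of `f`; this is where the symmetry of `𝔖ᵃᵇ` enters. -/
theorem sum_pd_mul_hamTwist (hS : ∀ a b, S a b = sgn (par a * par b) • S b a)
    (hu : u ∈ evenPart q V) (f : SF q V) :
    ∑ a, pd a u * hamTwist S a f = symbolForm S u f := by
  rw [symbolForm, Finset.sum_comm]
  refine Finset.sum_congr rfl fun a _ => ?_
  rw [hamTwist, map_sum, Finset.mul_sum]
  refine Finset.sum_congr rfl fun b _ => ?_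
  rw [twist_mul, twist_pd_twist, mul_smul_comm, mul_smul_comm, ← mul_assoc,
    pd_mul_eq_twist_mul_pd hu, twist_twist, hS a b, smul_mul_assoc, smul_mul_assoc, smul_smul,
    sgn_mul_self, one_smul]

theorem lapOf_smul (t : ℝ) (f : SF q V) : lapOf S ρ (t • f) = t • lapOf S ρ f := by
  simp only [lapOf, hamTwist_smul, mul_smul_comm, map_smul, ← Finset.smul_sum]

/-- Multiplication by an even function inside the divergence. -/
theorem inverse_mul_sum_pd_mul (hρ : ρ ∈ evenPart q V) (hρu : IsUnit ρ)
    (hS : ∀ a b, S a b = sgn (par a * par b) • S b a)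
    (hu : u ∈ evenPart q V) (f : SF q V) :
    Ring.inverse ρ * ∑ a, pd a (u * (ρ * hamTwist S a f)) =
      u * lapOf S ρ f + symbolForm S u f := by
  have h : ∀ a, pd a (u * (ρ * hamTwist S a f)) =
      u * pd a (ρ * hamTwist S a f) + ρ * (pd a u * hamTwist S a f) := by
    intro a
    rw [pd_mul, twist_of_mem_evenPart hu, add_comm, ← mul_assoc, evenPart_comm hρ, mul_assoc]
  simp only [h]
  rw [Finset.sum_add_distrib, ← Finset.mul_sum, ← Finset.mul_sum, sum_pd_mul_hamTwist hS hu,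
    mul_add, ← mul_assoc, ← mul_assoc, evenPart_comm hu, Ring.inverse_mul_cancel _ hρu, one_mul,
    mul_assoc, lapOf]

/-- The Laplacian is an operator of the second order, with the principal symbol `𝔖`. -/
theorem lapOf_mul (hρ : ρ ∈ evenPart q V) (hρu : IsUnit ρ)
    (hS : ∀ a b, S a b = sgn (par a * par b) • S b a)
    (hu : u ∈ evenPart q V) (f : SF q V) :
    lapOf S ρ (u * f) = lapOf S ρ u * f + u * lapOf S ρ f + (2 : ℝ) • symbolForm S u f := by
  have h : ∀ a, pd a (ρ * hamTwist S a (u * f)) =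
      pd a (u * (ρ * hamTwist S a f)) +
        (pd a (ρ * hamTwist S a u) * f + ρ * ∑ b, S a b * pd b u * pd a f) := by
    intro a
    have h₁ : ρ * hamTwist S a (u * f) =
        u * (ρ * hamTwist S a f) + ρ * hamTwist S a u * f := by
      rw [hamTwist_mul hu, mul_add, ← mul_assoc, evenPart_comm hu, mul_assoc, mul_assoc]
    rw [h₁, map_add, pd_mul a (ρ * hamTwist S a u) f, twist_mul, twist_of_mem_evenPart hρ,
      twist_hamTwist hu, mul_assoc, Finset.sum_mul]
  rw [lapOf]
  simp only [h]
  rw [Finset.sum_add_distrib, mul_add, inverse_mul_sum_pd_mul hρ hρu hS hu,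
    Finset.sum_add_distrib, ← Finset.sum_mul, ← Finset.mul_sum, mul_add, ← mul_assoc,
    ← mul_assoc, Ring.inverse_mul_cancel _ hρu, one_mul, ← lapOf, ← symbolForm, two_smul]
  abel

theorem lapOf_superExp (hρ : ρ ∈ evenPart q V) (hρu : IsUnit ρ)
    (hS : ∀ a b, S a b = sgn (par a * par b) • S b a) (hu : u ∈ evenPart q V) :
    lapOf S ρ (superExp u) = superExp u * (lapOf S ρ u + symbolForm S u u) := by
  have he := superExp_mem_evenPart hu
  have h : ∀ a, ρ * hamTwist S a (superExp u) = superExp u * (ρ * hamTwist S a u) := by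
    intro a
    rw [hamTwist_superExp hu, ← mul_assoc, evenPart_comm he, mul_assoc]
  rw [lapOf]
  simp only [h]
  rw [inverse_mul_sum_pd_mul hρ hρu hS he, symbolForm_superExp_left hu, mul_add]

/-- The change of the Laplacian on functions under a change of the volume form. -/
theorem lapOf_superExp_mul (hρ : ρ ∈ evenPart q V) (hρu : IsUnit ρ)
    (hS : ∀ a b, S a b = sgn (par a * par b) • S b a) (hu : u ∈ evenPart q V) (f : SF q V) :
    lapOf S (superExp u * ρ) f = lapOf S ρ f + symbolForm S u f := by
  have he := superExp_mem_evenPart hu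
  have heu := isUnit_superExp u
  have hinv : Ring.inverse (superExp u * ρ) = Ring.inverse (superExp u) * Ring.inverse ρ := by
    refine (heu.mul hρu).mul_left_cancel ?_
    rw [Ring.mul_inverse_cancel _ (heu.mul hρu), ← evenPart_comm he ρ, mul_assoc,
      ← mul_assoc (superExp u), Ring.mul_inverse_cancel _ heu, one_mul,
      Ring.mul_inverse_cancel _ hρu]
  rw [lapOf, hinv, mul_assoc]
  simp only [mul_assoc]
  rw [inverse_mul_sum_pd_mul hρ hρu hS he, symbolForm_superExp_left hu, ← mul_add, ← mul_assoc,
    Ring.inverse_mul_cancel _ heu, one_mul]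

/-! ### Change of the volume form -/

/-- Half of the Hamiltonian: `e^{-u/2} Δ_ρ e^{u/2} = ½ (Δ_ρ u - ½ {u, u})`. -/
theorem superExp_mul_lapOf_superExp (hρ : ρ ∈ evenPart q V) (hρu : IsUnit ρ)
    (hS : ∀ a b, S a b = sgn (par a * par b) • S b a) (hu : u ∈ evenPart q V) :
    superExp (-(1 / 2 : ℝ) • u) * lapOf S ρ (superExp ((1 / 2 : ℝ) • u)) =
      (1 / 2 : ℝ) • (lapOf S ρ u - (1 / 2 : ℝ) • SuperManifold.bracketOf S u u) := by
  rw [lapOf_superExp hρ hρu hS (Subalgebra.smul_mem _ hu _), ← mul_assoc,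
    superExp_neg_smul_mul, one_mul, lapOf_smul, symbolForm_smul_left, symbolForm_smul_right,
    bracketOf_eq_neg_symbolForm hu]
  module

/-- Conjugation with `e^{u/2}` turns the Laplacian of `e^u ρ` into that of `ρ` up to a function:
the first-order terms, `-{u, f}` from the volume form and `{u, f}` from the conjugation,
cancel. -/
theorem superExp_mul_lapOf_superExp_mul (hρ : ρ ∈ evenPart q V) (hρu : IsUnit ρ)
    (hS : ∀ a b, S a b = sgn (par a * par b) • S b a) (hu : u ∈ evenPart q V) (f : SF q V) :
    superExp ((1 / 2 : ℝ) • u) *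
        lapOf S (superExp u * ρ) (superExp (-(1 / 2 : ℝ) • u) * f) =
      lapOf S ρ f -
        (1 / 2 : ℝ) • ((lapOf S ρ u - (1 / 2 : ℝ) • SuperManifold.bracketOf S u u) * f) := by
  have hv : -(1 / 2 : ℝ) • u ∈ evenPart q V := Subalgebra.smul_mem _ hu _
  have he := superExp_mem_evenPart hv
  have hwv : superExp ((1 / 2 : ℝ) • u) * superExp (-(1 / 2 : ℝ) • u) = 1 := by
    rw [← evenPart_comm (superExp_mem_evenPart (Subalgebra.smul_mem _ hu _)),
      superExp_neg_smul_mul]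
  have hH : lapOf S ρ u - (1 / 2 : ℝ) • SuperManifold.bracketOf S u u =
      lapOf S ρ u + (1 / 2 : ℝ) • symbolForm S u u := by
    rw [bracketOf_eq_neg_symbolForm hu]
    module
  have h : lapOf S (superExp u * ρ) (superExp (-(1 / 2 : ℝ) • u) * f) =
      superExp (-(1 / 2 : ℝ) • u) * (lapOf S ρ f -
        (1 / 2 : ℝ) • ((lapOf S ρ u + (1 / 2 : ℝ) • symbolForm S u u) * f)) := by
    rw [lapOf_superExp_mul hρ hρu hS hu, lapOf_mul hρ hρu hS he, symbolForm_mul_right he,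
      lapOf_superExp hρ hρu hS hv, symbolForm_superExp_left hv, symbolForm_superExp_right hv,
      lapOf_smul, symbolForm_smul_left, symbolForm_smul_left, symbolForm_smul_right]
    simp only [mul_add, mul_sub, add_mul, mul_smul_comm, smul_mul_assoc, mul_assoc]
    module
  rw [hH, h, ← mul_assoc, hwv, one_mul]

end

namespace SuperManifold

variable {p q : ℕ} {M : SuperManifold.{u} p q}

theorem Chart.expr_mem_evenPart (c : M.Chart) {σ : M.Fn ⊤} (hσ : σ ∈ M.grading ⊤ 0) :
    c.expr σ ∈ evenPart q (M.img c.e c.dom) :=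
  homog_zero_le_evenPart
    ((c.iso_grading c.dom le_rfl 0 _).1 (M.grading_res ⊤ c.dom le_top 0 σ hσ))

theorem lapFun_eq_lapOf (S : M.OddPoissonStructure) (ρ : M.VolumeForm) (c : M.Chart)
    (f : c.Coef) : lapFun S ρ c f = lapOf (S.comp c) (ρ.coef c) f :=
  rfl

theorem lapHalf_eq_sub_hamH (S : M.OddPoissonStructure) {ρ ρ' : M.VolumeForm}
    (hρ : ρ.Nondegenerate) {σ : M.Fn ⊤} (hσ : σ ∈ M.grading ⊤ 0)
    (hρ' : ∀ c : M.Chart, ρ'.coef c = superExp (c.expr σ) * ρ.coef c)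
    (s : M.HalfDensity) (c : M.Chart) :
    lapHalf S ρ' s c = lapHalf S ρ s c - (1 / 2 : ℝ) • (hamH S ρ σ c * s.coef c) := by
  have hu := c.expr_mem_evenPart hσ
  have hρc := homog_zero_le_evenPart (ρ.even c)
  have hru := isUnit_absPow (1 / 2) (hρ c)
  have hr := absPow_mem_evenPart (1 / 2) hρc
  have hwu := isUnit_superExp ((1 / 2 : ℝ) • c.expr σ)
  have hwv := superExp_neg_smul_mul (1 / 2) (c.expr σ)
  simp only [lapHalf, lapFun_eq_lapOf, hamH, OddPoissonStructure.bracket]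
  have hinv : s.coef c * Ring.inverse
        (superExp ((1 / 2 : ℝ) • c.expr σ) * absPow (1 / 2) (ρ.coef c)) =
      superExp (-(1 / 2 : ℝ) • c.expr σ) *
        (s.coef c * Ring.inverse (absPow (1 / 2) (ρ.coef c))) := by
    have hv := superExp_mem_evenPart (Subalgebra.smul_mem _ hu (-(1 / 2 : ℝ)))
    rw [← mul_assoc, ← evenPart_comm hv, mul_assoc]
    congr 1
    refine (hwu.mul hru).mul_right_cancel ?_
    rw [Ring.inverse_mul_cancel _ (hwu.mul hru), evenPart_comm hr, mul_assoc,
      ← mul_assoc (Ring.inverse _), Ring.inverse_mul_cancel _ hru, one_mul, hwv]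
  rw [hρ' c, absPow_half_superExp_mul hu hρc (hρ c), hinv, evenPart_comm hr, mul_assoc,
    superExp_mul_lapOf_superExp_mul hρc (hρ c) (S.symm c) hu, mul_sub, mul_smul_comm]
  congr 2
  rw [← evenPart_comm hr, mul_assoc, mul_assoc, Ring.inverse_mul_cancel _ hru, mul_one]

end SuperManifold

end OddPoisson

open OddPoisson OddPoisson.SuperManifold in
theorem mainTheorem2 {p q : ℕ} (M : SuperManifold.{u} p q) (S : M.OddPoissonStructure)
    (ρ ρ' : M.VolumeForm) (hρ : ρ.Nondegenerate)
    (σ : M.Fn ⊤) (hσ : σ ∈ M.grading ⊤ 0)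
    (hρ' : ∀ c : M.Chart, ρ'.coef c = superExp (c.expr σ) * ρ.coef c) :
    (∀ (s : M.HalfDensity) (c : M.Chart),
      lapHalf S ρ' s c = lapHalf S ρ s c -
        superExp (-(1 / 2 : ℝ) • c.expr σ) *
          lapFun S ρ c (superExp ((1 / 2 : ℝ) • c.expr σ)) * s.coef c) ∧
    (∀ (s : M.HalfDensity) (c : M.Chart),
      lapHalf S ρ' s c = lapHalf S ρ s c - (1 / 2 : ℝ) • (hamH S ρ σ c * s.coef c)) ∧
    (∀ c : M.Chart,
      hamH S ρ σ c = (2 : ℝ) • (superExp (-(1 / 2 : ℝ) • c.expr σ) *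
        lapFun S ρ c (superExp ((1 / 2 : ℝ) • c.expr σ)))) := by
  have hH : ∀ c : M.Chart, superExp (-(1 / 2 : ℝ) • c.expr σ) *
      lapFun S ρ c (superExp ((1 / 2 : ℝ) • c.expr σ)) = (1 / 2 : ℝ) • hamH S ρ σ c := fun c =>
    superExp_mul_lapOf_superExp (homog_zero_le_evenPart (ρ.even c)) (hρ c) (S.symm c)
      (c.expr_mem_evenPart hσ)
  refine ⟨fun s c => ?_, lapHalf_eq_sub_hamH S hρ hσ hρ', fun c => ?_⟩
  · rw [hH, smul_mul_assoc, lapHalf_eq_sub_hamH S hρ hσ hρ']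
  · rw [hH, smul_smul]
    norm_num
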